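/- Consider a memoryless channel with three inputs $X_i\in\mathcal X_i$ and three outputs $Y_i\in\mathcal Y_i$ ($i=1,2,3$), where all alphabets are standard Borel spaces (for instance finite sets, or $\mathbb R^d$, $\mathbb C^d$), given by a transition probability kernel $P(Y_1,Y_2,Y_3\mid X_1,X_2,X_3)$. In the 3-user cognitive interference channel with cognitive-only message sharing (3-CIFC-CoMS), a code of block length $N$ with rates $R_1,R_2,R_3\ge 0$ has independent messages $W_i$, uniform on $\{1,\dots,\lfloor 2^{NR_i}\rfloor\}$; encoders $X_1^N=f_1(W_1)$ and $X_2^N=f_2(W_2)$ for the two primary users and $X_3^N=f_3(W_1,W_2,W_3)$ for the cognitive user; and (measurable) decoders $\widehat W_i=g_i(Y_i^N)$. The capacity region $\mathcal C$ is the set of all triples $(R_1,R_2,R_3)$ with nonnegative entries for which there is a sequence of such codes, indexed by $N$, with $\max_i\mathbb P[\widehat W_i\ne W_i]\to0$ as $N\to\infty$. For a probability distribution $P=P_{X_1,X_2,X_3}$ on $\mathcal X_1\times\mathcal X_2\times\mathcal X_3$ let $\mathcal R(P)$ be the set of triples $(R_1,R_2,R_3)$ with $$\begin{aligned} R_1&\le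 I(Y_1;X_1,X_3\mid X_2),\\ R_2&\le I(Y_2;X_2,X_3\mid X_1),\\ R_3&\le I(Y_3;X_3\mid X_1,X_2),\\ R_1+R_3&\le I(Y_1;X_1,X_3\mid X_2)+I(Y_3;X_3\mid X_2,X_1,Y_1),\\ R_2+R_3&\le I(Y_2;X_2,X_3\mid X_1)+I(Y_3;X_3\mid X_1,X_2,Y_2),\\ R_1+R_2+R_3&\le I(Y_1;X_1,X_2,X_3)+I(Y_2;X_2,X_3\mid X_1,Y_1)+I(Y_3;X_3\mid X_1,Y_1,X_2,Y_2),\\ R_2+R_1+R_3&\le I(Y_2;X_2,X_1,X_3)+I(Y_1;X_1,X_3\mid X_2,Y_2)+I(Y_3;X_3\mid X_2,Y_2,X_1,Y_1), \end{aligned}$$ where the mutual informations (in bits, possibly $+\infty$) are computed for inputs distributed according to $P$ and outputs given by the channel. Then $\mathcal C$ is contained in the closure of $\bigcup_P\mathcal R(P)$. If moreover the input alphabets $\mathcal X_1,\mathcal X_2,\mathcal X_3$ are finite, then $\mathcal C\subseteq\bigcup_P\mathcal R(P)$, that is, every triple in the capacity region satisfies the seven bounds for some joint input distribution $P_{X_1,X_2,X_3}$.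 -/

import Mathlib

open MeasureTheory ProbabilityTheory InformationTheory Filter
open scoped ENNReal Topology

noncomputable section

namespace CIFC

universe u v

/-- The mutual information `I(Y; X)` in bits under the law `μ`, namely the Kullback-Leibler
divergence of the joint law from the product of the marginals (`∞` is allowed). -/
def mutualInfo {Ω α β : Type*} [MeasurableSpace Ω] [MeasurableSpace α] [MeasurableSpace β]
    (μ : Measure Ω) (Y : Ω → α) (X : Ω → β) : ℝ≥0∞ :=
  klDiv (μ.map fun ω => (X ω, Y ω)) ((μ.map X).prod (μ.map Y)) / ENNReal.ofReal (Real.log 2)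

/-- The conditional mutual information `I(Y; X | Z)` in bits under the law `μ`, namely the
Kullback-Leibler divergence of the joint law `P_{Z,X,Y}` from `P_{Z,X} ⊗ P_{Y|Z}`, the law with the
same `(Z, X)`- and `(Z, Y)`-marginals that makes `X` and `Y` conditionally independent given `Z`. -/
def condMutualInfo {Ω α β γ : Type*} [MeasurableSpace Ω] [MeasurableSpace α]
    [StandardBorelSpace α] [Nonempty α] [MeasurableSpace β] [MeasurableSpace γ]
    (μ : Measure Ω) [IsFiniteMeasure μ] (Y : Ω → α) (X : Ω → β) (Z : Ω → γ) : ℝ≥0∞ :=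
  klDiv (μ.map fun ω => ((Z ω, X ω), Y ω))
      ((μ.map fun ω => (Z ω, X ω)) ⊗ₘ (condDistrib Y Z μ).prodMkRight β)
    / ENNReal.ofReal (Real.log 2)

/-- The number of messages `⌊2 ^ (N r)⌋` at rate `r` (bits per channel use) and block length `N`. -/
def numMsg (N : ℕ) (r : ℝ) : ℕ := ⌊(2 : ℝ) ^ ((N : ℝ) * r)⌋₊

/-- Message triples `(W₁, W₂, W₃)`. The users `1, 2, 3` carry the indices `0, 1, 2`. -/
abbrev Msg (N : ℕ) (R : Fin 3 → ℝ) : Type := ∀ i, Fin (numMsg N (R i))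

/-- A block code with rate vector `R` and block length `N` for three users with cognitive-only
message sharing: each primary encoder sees its own message only, the cognitive one sees all. -/
structure Code (𝒳 : Fin 3 → Type u) (𝒴 : Fin 3 → Type v) [∀ i, MeasurableSpace (𝒴 i)]
    (R : Fin 3 → ℝ) (N : ℕ) where
  enc₁ : Fin (numMsg N (R 0)) → Fin N → 𝒳 0
  enc₂ : Fin (numMsg N (R 1)) → Fin N → 𝒳 1
  enc₃ : Msg N R → Fin N → 𝒳 2
  dec : ∀ i, (Fin N → 𝒴 i) → Fin (numMsg N (R i))
  measurable_dec : ∀ i, Measurable (dec i)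

section

variable {𝒳 : Fin 3 → Type u} {𝒴 : Fin 3 → Type v}
  [∀ i, MeasurableSpace (𝒳 i)] [∀ i, MeasurableSpace (𝒴 i)]

/-- The channel inputs at time `t` when the messages are `w`. -/
def Code.input {R : Fin 3 → ℝ} {N : ℕ} (c : Code 𝒳 𝒴 R N) (w : Msg N R) (t : Fin N) :
    ∀ i, 𝒳 i
  | 0 => c.enc₁ (w 0) t
  | 1 => c.enc₂ (w 1) t
  | 2 => c.enc₃ w t

/-- The law of the outputs of `N` uses of the memoryless channel with input sequence `x`. -/
def blockLaw (ch : Kernel (∀ i, 𝒳 i) (∀ i, 𝒴 i)) {N : ℕ} (x : Fin N → ∀ i, 𝒳 i) :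
    Measure (Fin N → ∀ i, 𝒴 i) :=
  Measure.pi fun t => ch (x t)

/-- The error probability `ℙ[Ŵᵢ ≠ Wᵢ]` of user `i`. The messages are independent and uniform, so
it is the average over all message triples of the conditional error probabilities. -/
def Code.errorProb (ch : Kernel (∀ i, 𝒳 i) (∀ i, 𝒴 i)) {R : Fin 3 → ℝ} {N : ℕ}
    (c : Code 𝒳 𝒴 R N) (i : Fin 3) : ℝ :=
  (∑ w : Msg N R, (blockLaw ch (c.input w)).real {y | c.dec i (fun t => y t i) ≠ w i})
    / Fintype.card (Msg N R)

/-- The capacity region: all non-negative rate triples for which some sequence of codes, indexed by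
the block length, has vanishing maximal (over the users) average error probability. -/
def capacityRegion (ch : Kernel (∀ i, 𝒳 i) (∀ i, 𝒴 i)) : Set (Fin 3 → ℝ) :=
  {R | (∀ i, 0 ≤ R i) ∧
    ∃ c : ∀ N, Code 𝒳 𝒴 R N, Tendsto (fun N => ⨆ i, (c N).errorProb ch i) atTop (𝓝 0)}

/-- The rate triples that satisfy the seven bounds for the input distribution `P`; all mutual
informations are computed under the joint law `P ⊗ₘ ch` of inputs and outputs. -/
def outerRegion [∀ i, StandardBorelSpace (𝒴 i)] [∀ i, Nonempty (𝒴 i)]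
    (ch : Kernel (∀ i, 𝒳 i) (∀ i, 𝒴 i)) [IsMarkovKernel ch]
    (P : ProbabilityMeasure (∀ i, 𝒳 i)) : Set (Fin 3 → ℝ) :=
  let μ : Measure ((∀ i, 𝒳 i) × (∀ i, 𝒴 i)) := (P : Measure (∀ i, 𝒳 i)) ⊗ₘ ch
  let X₁ : (∀ i, 𝒳 i) × (∀ i, 𝒴 i) → 𝒳 0 := fun ω => ω.1 0
  let X₂ : (∀ i, 𝒳 i) × (∀ i, 𝒴 i) → 𝒳 1 := fun ω => ω.1 1
  let X₃ : (∀ i, 𝒳 i) × (∀ i, 𝒴 i) → 𝒳 2 := fun ω => ω.1 2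
  let Y₁ : (∀ i, 𝒳 i) × (∀ i, 𝒴 i) → 𝒴 0 := fun ω => ω.2 0
  let Y₂ : (∀ i, 𝒳 i) × (∀ i, 𝒴 i) → 𝒴 1 := fun ω => ω.2 1
  let Y₃ : (∀ i, 𝒳 i) × (∀ i, 𝒴 i) → 𝒴 2 := fun ω => ω.2 2
  {R |
    ENNReal.ofReal (R 0) ≤ condMutualInfo μ Y₁ (fun ω => (X₁ ω, X₃ ω)) X₂ ∧
    ENNReal.ofReal (R 1) ≤ condMutualInfo μ Y₂ (fun ω => (X₂ ω, X₃ ω)) X₁ ∧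
    ENNReal.ofReal (R 2) ≤ condMutualInfo μ Y₃ X₃ (fun ω => (X₁ ω, X₂ ω)) ∧
    ENNReal.ofReal (R 0 + R 2) ≤
      condMutualInfo μ Y₁ (fun ω => (X₁ ω, X₃ ω)) X₂
        + condMutualInfo μ Y₃ X₃ (fun ω => (X₂ ω, X₁ ω, Y₁ ω)) ∧
    ENNReal.ofReal (R 1 + R 2) ≤
      condMutualInfo μ Y₂ (fun ω => (X₂ ω, X₃ ω)) X₁
        + condMutualInfo μ Y₃ X₃ (fun ω => (X₁ ω, X₂ ω, Y₂ ω)) ∧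
    ENNReal.ofReal (R 0 + R 1 + R 2) ≤
      mutualInfo μ Y₁ (fun ω => (X₁ ω, X₂ ω, X₃ ω))
        + condMutualInfo μ Y₂ (fun ω => (X₂ ω, X₃ ω)) (fun ω => (X₁ ω, Y₁ ω))
        + condMutualInfo μ Y₃ X₃ (fun ω => (X₁ ω, Y₁ ω, X₂ ω, Y₂ ω)) ∧
    ENNReal.ofReal (R 1 + R 0 + R 2) ≤
      mutualInfo μ Y₂ (fun ω => (X₂ ω, X₁ ω, X₃ ω))
        + condMutualInfo μ Y₁ (fun ω => (X₁ ω, X₃ ω)) (fun ω => (X₂ ω, Y₂ ω))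
        + condMutualInfo μ Y₃ X₃ (fun ω => (X₂ ω, Y₂ ω, X₁ ω, Y₁ ω))}

end

end CIFC

end

/-! The converse is a change of measure. For an ordering of a set of users, the true channel is
compared with a memoryless reference channel that produces their outputs one after another, each
`Y_j` from the earlier outputs and from primary inputs other than `X_j`. These inputs do not involve
`W_j`, so under the reference the users decode jointly with exactly the probability `∏ 1/M_i` of a
blind guess (`IsReference.append`), where `M_i` is the number of messages. Under the true channel a
good code succeeds with probability near one, so `ofReal_event_le_klDiv` makes the message-averaged
divergence of the block laws at least about `log ∏ M_i`. Both channels being memoryless, this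
divergence is a sum over time, hence an average under the law of the input at a uniform time
(`IsReference.ofReal_rate_le`). If the reference uses the true conditional laws of the outputs, the
chain rule splits the divergence into conditional mutual informations; each of the seven bounds is
one ordering (`mem_outerRegion_of_attains`).

The rates minus a vanishing slack thus lie in the region of the code's own input law, which gives
the closure. For finite alphabets these input laws converge along a subsequence to some `P`. With a
fixed reference built for `P`, the averaged divergence is linear in the input law and passes to the
limit once it is finite at every input; mixing in a little of the reference built for the uniform
law ensures this. Continuity of mutual information is never needed. -/

/-! ### Kullback-Leibler divergence: event bound, tensorization, averaging over inputs. -/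

section KullbackLeibler

/-- Fenchel's inequality for `klFun`, whose convex conjugate is `a ↦ exp a - 1`. -/
lemma mul_sub_exp_sub_one_le_klFun (a : ℝ) {t : ℝ} (ht : 0 ≤ t) :
    a * t - (Real.exp a - 1) ≤ klFun t := by
  rcases ht.eq_or_lt with rfl | ht
  · simp [klFun_zero, (Real.exp_pos a).le]
  have h := Real.log_le_sub_one_of_pos (div_pos (Real.exp_pos a) ht)
  rw [Real.log_div (Real.exp_pos a).ne' ht.ne', Real.log_exp] at h
  have h2 := mul_le_mul_of_nonneg_left h ht.le
  have h3 : t * (Real.exp a / t - 1) = Real.exp a - t := by field_simp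
  rw [klFun_apply]
  nlinarith

lemma setIntegral_klFun_ge {α : Type*} {mα : MeasurableSpace α} {μ ν : Measure α}
    [IsFiniteMeasure μ] [IsFiniteMeasure ν] (hμν : μ ≪ ν)
    (hint : Integrable (fun x => klFun (μ.rnDeriv ν x).toReal) ν) (s : Set α) (a : ℝ) :
    a * μ.real s - (Real.exp a - 1) * ν.real s
      ≤ ∫ x in s, klFun (μ.rnDeriv ν x).toReal ∂ν := by
  have hi : Integrable (fun x => (μ.rnDeriv ν x).toReal) (ν.restrict s) :=
    Measure.integrable_toReal_rnDeriv.integrableOn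
  calc a * μ.real s - (Real.exp a - 1) * ν.real s
      = ∫ x in s, (a * (μ.rnDeriv ν x).toReal - (Real.exp a - 1)) ∂ν := by
        rw [integral_sub (hi.const_mul a) (integrable_const _), integral_const_mul,
          Measure.setIntegral_toReal_rnDeriv hμν]
        simp [mul_comm]
    _ ≤ _ := integral_mono ((hi.const_mul a).sub (integrable_const _)) hint.integrableOn
        fun x => mul_sub_exp_sub_one_le_klFun a ENNReal.toReal_nonneg

/-- A lower bound for the divergence in terms of the probabilities of a single event. -/
lemma ofReal_event_le_klDiv {α : Type*} {mα : MeasurableSpace α} (μ ν : Measure α)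
    [IsProbabilityMeasure μ] [IsProbabilityMeasure ν] {A : Set α} (hA : MeasurableSet A) (s : ℝ) :
    ENNReal.ofReal (s * μ.real A - Real.log 2 - (Real.exp s * ν.real A - 1) / 2)
      ≤ klDiv μ ν := by
  by_cases h : klDiv μ ν = ∞
  · simp [h]
  obtain ⟨hac, hllr⟩ := klDiv_ne_top_iff.1 h
  have hint := (integrable_klFun_rnDeriv_iff hac).2 hllr
  rw [← ENNReal.ofReal_toReal h, toReal_klDiv_eq_integral_klFun hac,
    ← integral_add_compl hA hint]
  refine ENNReal.ofReal_le_ofReal ?_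
  -- These slopes turn `exp a` into `exp s / 2` on `A` and `1 / 2` off `A`. The bound is then linear
  -- in `ν A`, and its last term vanishes on average when `exp s * ν A` has mean one.
  have h1 := setIntegral_klFun_ge hac hint A (s - Real.log 2)
  have h2 := setIntegral_klFun_ge hac hint Aᶜ (- Real.log 2)
  rw [Real.exp_sub, Real.exp_log two_pos] at h1
  rw [Real.exp_neg, Real.exp_log two_pos, probReal_compl_eq_one_sub hA,
    probReal_compl_eq_one_sub hA] at h2
  have h3 : 0 ≤ ν.real A := measureReal_nonneg
  nlinarith

/-- Replacing the second argument by a measure that dominates a multiple of it changes the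
divergence by at most the logarithm of the factor. -/
lemma klDiv_le_add_log_of_smul_le {α : Type*} {mα : MeasurableSpace α} (μ ν ν' : Measure α)
    [IsProbabilityMeasure μ] [IsProbabilityMeasure ν] [IsProbabilityMeasure ν'] {a : ℝ}
    (ha : 0 < a) (ha1 : a ≤ 1) (h : ENNReal.ofReal a • ν ≤ ν') :
    klDiv μ ν' ≤ klDiv μ ν + ENNReal.ofReal (- Real.log a) := by
  by_cases hμν : μ ≪ ν
  swap
  · simp [hμν]
  have ha0 : ENNReal.ofReal a ≠ 0 := by simpa using ha
  have hνν' : ν ≪ ν' := (Measure.absolutelyContinuous_smul ha0).trans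
    (Measure.absolutelyContinuous_of_le h)
  have hlog : 0 ≤ - Real.log a := by
    have := Real.log_nonpos ha.le ha1
    linarith
  rw [klDiv_eq_lintegral_klFun_of_ac hμν, klDiv_eq_lintegral_klFun_of_ac (hμν.trans hνν')]
  set f := μ.rnDeriv ν with hf
  set g := ν.rnDeriv ν' with hg
  -- The added `1` is `∫ g ∂ν'`; it absorbs the affine parts of `klFun`, so that no subtraction
  -- occurs. What remains pointwise is `f g log g ≤ -log a * f g`, which holds as `g ≤ 1 / a`.
  have key : (∫⁻ x, ENNReal.ofReal (klFun (μ.rnDeriv ν' x).toReal) ∂ν') + 1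
      ≤ (∫⁻ x, ENNReal.ofReal (klFun (f x).toReal) ∂ν + ENNReal.ofReal (- Real.log a)) + 1 := by
    have e1 : ∫⁻ x, g x ∂ν' = 1 := by
      rw [hg, Measure.lintegral_rnDeriv hνν']; simp
    have e2 : ∫⁻ x, ENNReal.ofReal (klFun (f x).toReal) ∂ν
        = ∫⁻ x, g x * ENNReal.ofReal (klFun (f x).toReal) ∂ν' := by
      rw [hg, lintegral_rnDeriv_mul hνν' (by fun_prop)]
    have e3 : ∫⁻ x, μ.rnDeriv ν' x ∂ν' = 1 := by
      rw [Measure.lintegral_rnDeriv (hμν.trans hνν')]; simp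
    have hga : ∀ᵐ x ∂ν', ENNReal.ofReal a * g x ≤ 1 := by
      have h1 := Measure.rnDeriv_smul_left_of_ne_top ν ν' (r := ENNReal.ofReal a) (by simp)
      filter_upwards [Measure.rnDeriv_le_one_of_le h, h1] with x hx hx1
      rw [hx1] at hx
      simpa using hx
    calc _ = ∫⁻ x, (ENNReal.ofReal (klFun (μ.rnDeriv ν' x).toReal) + g x) ∂ν' := by
          rw [lintegral_add_right _ (by fun_prop), e1]
      _ ≤ ∫⁻ x, (g x * ENNReal.ofReal (klFun (f x).toReal)
            + ENNReal.ofReal (- Real.log a) * μ.rnDeriv ν' x + 1) ∂ν' := by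
          refine lintegral_mono_ae ?_
          filter_upwards [hga, Measure.rnDeriv_mul_rnDeriv (κ := ν') hμν,
            Measure.rnDeriv_lt_top μ ν', Measure.rnDeriv_lt_top ν ν'] with x hx hmul hft hgt
          simp only [Pi.mul_apply] at hmul
          rw [← hmul] at hft ⊢
          change f x * g x < ∞ at hft
          change ENNReal.ofReal (klFun (f x * g x).toReal) + g x ≤
            g x * ENNReal.ofReal (klFun (f x).toReal) + ENNReal.ofReal (- Real.log a) * (f x * g x)
              + 1
          have hgt' : g x ≠ ∞ := hgt.ne
          rcases eq_or_ne (g x) 0 with h0 | h0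
          · simp [h0, klFun_zero]
          have hfx : f x ≠ ∞ := by
            intro htop
            simp [htop, ENNReal.top_mul h0] at hft
          lift f x to NNReal using hfx with u
          lift g x to NNReal using hgt' with v
          have hv : 0 < (v : ℝ) := by
            have : v ≠ 0 := by simpa using h0
            positivity
          have hav : a * v ≤ 1 := by
            have := ENNReal.toReal_mono ENNReal.one_ne_top hx
            simpa [ENNReal.toReal_mul, ENNReal.toReal_ofReal ha.le] using this
          rw [← ENNReal.coe_mul]
          simp only [ENNReal.coe_toReal, NNReal.coe_mul]
          rw [← ENNReal.ofReal_coe_nnreal (p := v), ← ENNReal.ofReal_coe_nnreal (p := u * v),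
            ← ENNReal.ofReal_mul v.coe_nonneg, ← ENNReal.ofReal_mul hlog, ← ENNReal.ofReal_one,
            ← ENNReal.ofReal_add (klFun_nonneg (by positivity)) (by positivity),
            ← ENNReal.ofReal_add (mul_nonneg v.coe_nonneg (klFun_nonneg u.coe_nonneg))
              (mul_nonneg hlog (by positivity)),
            ← ENNReal.ofReal_add (add_nonneg (mul_nonneg v.coe_nonneg (klFun_nonneg u.coe_nonneg))
              (mul_nonneg hlog (by positivity))) zero_le_one]
          refine ENNReal.ofReal_le_ofReal ?_
          simp only [klFun_apply, NNReal.coe_mul]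
          rcases eq_or_ne (u : ℝ) 0 with hu | hu
          · rw [hu]; simp; linarith
          have hlv : Real.log a + Real.log v ≤ 0 := by
            rw [← Real.log_mul ha.ne' hv.ne']
            exact Real.log_nonpos (by positivity) hav
          rw [Real.log_mul hu hv.ne']
          have : (u : ℝ) * v * (Real.log a + Real.log v) ≤ 0 :=
            mul_nonpos_of_nonneg_of_nonpos (by positivity) hlv
          nlinarith
      _ = _ := by
          rw [lintegral_add_right _ measurable_const, lintegral_add_right _ (by fun_prop),
            lintegral_const_mul _ (by fun_prop), e3, ← e2]
          simp
  exact (ENNReal.add_le_add_iff_right ENNReal.one_ne_top).1 key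

lemma klDiv_ne_top_of_le {α : Type*} {mα : MeasurableSpace α} (μ ν : Measure α)
    [IsFiniteMeasure ν] (h : μ ≤ ν) : klDiv μ ν ≠ ∞ := by
  have : IsFiniteMeasure μ := isFiniteMeasure_of_le ν h
  rw [klDiv_eq_lintegral_klFun_of_ac (Measure.absolutelyContinuous_of_le h)]
  refine (lt_of_le_of_lt (lintegral_mono_ae (g := fun _ => 1) ?_) ?_).ne
  · filter_upwards [Measure.rnDeriv_le_one_of_le h] with x hx
    rw [ENNReal.ofReal_le_one, klFun_apply]
    have h1 : (μ.rnDeriv ν x).toReal ≤ 1 :=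
      ENNReal.toReal_le_of_le_ofReal zero_le_one (by simpa using hx)
    have h0 : 0 ≤ (μ.rnDeriv ν x).toReal := ENNReal.toReal_nonneg
    have := mul_nonpos_of_nonneg_of_nonpos h0 (Real.log_nonpos h0 h1)
    linarith
  · simp

/-- Data processing applied to `e` and then to `g`. -/
lemma klDiv_map_of_leftInverse {α β : Type*} {mα : MeasurableSpace α} {mβ : MeasurableSpace β}
    (μ ν : Measure α) [IsFiniteMeasure μ] [IsFiniteMeasure ν] {e : α → β} {g : β → α}
    (he : Measurable e) (hg : Measurable g) (hge : Function.LeftInverse g e) :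
    klDiv (μ.map e) (ν.map e) = klDiv μ ν := by
  refine le_antisymm (klDiv_map_le _ _ he) ?_
  have h := klDiv_map_le (μ.map e) (ν.map e) hg
  rwa [Measure.map_map hg he, Measure.map_map hg he, hge.comp_eq_id, Measure.map_id,
    Measure.map_id] at h

lemma klDiv_prod {α β : Type*} {mα : MeasurableSpace α} {mβ : MeasurableSpace β}
    (μ ν : Measure α) (μ' ν' : Measure β) [IsProbabilityMeasure μ] [IsProbabilityMeasure ν]
    [IsProbabilityMeasure μ'] [IsProbabilityMeasure ν'] :
    klDiv (μ.prod μ') (ν.prod ν') = klDiv μ ν + klDiv μ' ν' := by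
  rw [← Measure.compProd_const, ← Measure.compProd_const, klDiv_compProd_eq_add,
    Measure.compProd_const, Measure.compProd_const]
  congr 1
  rw [← klDiv_map_of_leftInverse (μ.prod μ') (μ.prod ν') measurable_swap measurable_swap
    Prod.swap_leftInverse, Measure.prod_swap, Measure.prod_swap, ← Measure.compProd_const,
    ← Measure.compProd_const, klDiv_compProd_left]

lemma klDiv_pi {α : Type*} [MeasurableSpace α] {N : ℕ} (μ ν : Fin N → Measure α)
    [∀ t, IsProbabilityMeasure (μ t)] [∀ t, IsProbabilityMeasure (ν t)] :
    klDiv (Measure.pi μ) (Measure.pi ν) = ∑ t, klDiv (μ t) (ν t) := by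
  induction N with
  | zero =>
    have : Measure.pi μ = Measure.pi ν := by
      rw [Measure.pi_of_empty μ, Measure.pi_of_empty ν]
    simp [this]
  | succ n ih =>
    have h1 := (measurePreserving_piFinSuccAbove μ 0).map_eq
    have h2 := (measurePreserving_piFinSuccAbove ν 0).map_eq
    rw [← klDiv_map_of_leftInverse _ _ (MeasurableEquiv.piFinSuccAbove (fun _ => α) 0).measurable
      (MeasurableEquiv.piFinSuccAbove (fun _ => α) 0).symm.measurable
      (MeasurableEquiv.piFinSuccAbove (fun _ => α) 0).left_inv, h1, h2, klDiv_prod, ih,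
      Fin.sum_univ_succ]
    simp

/-- For an input law with finite support, the divergence of the joint laws dominates the averaged
divergence of the kernels. -/
lemma lintegral_klDiv_le_klDiv_compProd {α β ι : Type*} [Fintype ι] [MeasurableSpace α]
    [MeasurableSingletonClass α] [MeasurableSpace β] (κ η : Kernel α β) [IsMarkovKernel κ]
    [IsMarkovKernel η] (p : ι → ℝ≥0∞) (x : ι → α) (P : Measure α) [IsFiniteMeasure P]
    (hP : P = ∑ i, p i • Measure.dirac (x i)) :
    ∫⁻ a, klDiv (κ a) (η a) ∂P ≤ klDiv (P ⊗ₘ κ) (P ⊗ₘ η) := by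
  by_cases hac : P ⊗ₘ κ ≪ P ⊗ₘ η
  swap
  · simp [hac]
  set f := (P ⊗ₘ κ).rnDeriv (P ⊗ₘ η) with hf
  have hfm : Measurable f := Measure.measurable_rnDeriv _ _
  -- At an atom of `P` the section of the joint density is a density of `κ a`, with no exceptional
  -- null set; the atoms carry all of `P`.
  have hatom : ∀ a, P {a} ≠ 0 → κ a = (η a).withDensity fun y => f (a, y) := by
    intro a ha
    ext s hs
    rw [withDensity_apply _ hs]
    have h1 : (P ⊗ₘ κ) ({a} ×ˢ s) = P {a} * κ a s := by
      rw [Measure.compProd_apply_prod (measurableSet_singleton a) hs]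
      simp
    have h2 : (P ⊗ₘ κ) ({a} ×ˢ s) = P {a} * ∫⁻ y in s, f (a, y) ∂(η a) := by
      rw [← Measure.setLIntegral_rnDeriv hac, Measure.setLIntegral_compProd hfm
        (measurableSet_singleton a) hs]
      simp [mul_comm, hf]
    rw [h1] at h2
    exact (ENNReal.mul_right_inj ha (measure_ne_top _ _)).1 h2
  rw [klDiv_eq_lintegral_klFun_of_ac hac, Measure.lintegral_compProd (by fun_prop)]
  refine lintegral_mono_ae ?_
  have hae : ∀ᵐ a ∂P, P {a} ≠ 0 := by
    rw [ae_iff]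
    simp only [not_not]
    have : {a | P {a} = 0} = {a | ∀ i, p i ≠ 0 → x i ≠ a} := by
      ext a
      simp only [Set.mem_ofPred_eq, hP, Measure.coe_finsetSum, Finset.sum_apply, Measure.smul_apply,
        smul_eq_mul, Finset.sum_eq_zero_iff, Finset.mem_univ, true_imp_iff, mul_eq_zero,
        Measure.dirac_apply, Set.indicator_apply_eq_zero, Set.mem_singleton_iff]
      simp [imp_iff_not_or]
    rw [this, hP]
    simp only [Measure.coe_finsetSum, Finset.sum_apply, Measure.smul_apply, smul_eq_mul,
      Finset.sum_eq_zero_iff, Finset.mem_univ, true_imp_iff, mul_eq_zero, Measure.dirac_apply,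
      Set.indicator_apply_eq_zero]
    intro i
    by_cases hi : p i = 0
    · exact Or.inl hi
    · exact Or.inr fun h => absurd rfl (h i hi)
  filter_upwards [hae] with a ha
  have hκ := hatom a ha
  have hac' : κ a ≪ η a := by
    rw [hκ]; exact withDensity_absolutelyContinuous _ _
  rw [klDiv_eq_lintegral_klFun_of_ac hac']
  refine (lintegral_congr_ae ?_).le
  have := Measure.rnDeriv_withDensity (η a) (f := fun y => f (a, y)) (by fun_prop)
  rw [← hκ] at this
  filter_upwards [this] with y hy
  rw [hy]

end KullbackLeibler

/-! ### Conditional mutual information as a divergence, its finiteness, and the chain rule. -/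

section ConditionalInformation

lemma compProd_comap_map {𝒜 δ α : Type*} [MeasurableSpace 𝒜] [MeasurableSpace δ]
    [MeasurableSpace α] (m : Measure 𝒜) [SFinite m] (Q : Kernel δ α) [IsSFiniteKernel Q]
    {e : 𝒜 → δ} (he : Measurable e) :
    (m ⊗ₘ Q.comap e he).map (Prod.map e id) = m.map e ⊗ₘ Q := by
  have hem : Measurable (Prod.map e (id : α → α)) := he.prodMap measurable_id
  ext s hs
  rw [Measure.map_apply hem hs, Measure.compProd_apply (hem hs), Measure.compProd_apply hs,
    lintegral_map (Kernel.measurable_kernel_prodMk_left hs) he]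
  rfl

/-- The divergence from a conditionally independent law is unchanged when the pair of
conditioning and input variables is replaced by an equivalent variable. -/
lemma klDiv_compProd_comap_eq {Ω 𝒜 α β γ : Type*} [MeasurableSpace Ω] [MeasurableSpace 𝒜]
    [MeasurableSpace α] [MeasurableSpace β] [MeasurableSpace γ] (μ : Measure Ω)
    [IsFiniteMeasure μ] {A : Ω → 𝒜} (hA : Measurable A) {Y : Ω → α} (hY : Measurable Y)
    {Z : 𝒜 → γ} (hZ : Measurable Z) {ξ : 𝒜 → β} (hξ : Measurable ξ) {g : γ × β → 𝒜}
    (hg : Measurable g) (hge : ∀ a, g (Z a, ξ a) = a) (Q : Kernel γ α) [IsMarkovKernel Q] :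
    klDiv (μ.map fun ω => (A ω, Y ω)) (μ.map A ⊗ₘ Q.comap Z hZ)
      = klDiv (μ.map fun ω => ((Z (A ω), ξ (A ω)), Y ω))
          ((μ.map fun ω => (Z (A ω), ξ (A ω))) ⊗ₘ Q.prodMkRight β) := by
  set e : 𝒜 → γ × β := fun a => (Z a, ξ a) with he_def
  have he : Measurable e := hZ.prodMk hξ
  have h1 : (μ.map fun ω => ((Z (A ω), ξ (A ω)), Y ω))
      = (μ.map fun ω => (A ω, Y ω)).map (Prod.map e id) := by
    rw [Measure.map_map (he.prodMap measurable_id) (hA.prodMk hY)]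
    rfl
  have h2 : (μ.map fun ω => (Z (A ω), ξ (A ω))) = (μ.map A).map e := by
    rw [Measure.map_map he hA]
    rfl
  have h3 : Q.comap Z hZ = (Q.prodMkRight β).comap e he := rfl
  rw [h1, h2, h3, ← compProd_comap_map _ _ he]
  refine (klDiv_map_of_leftInverse _ _ (he.prodMap measurable_id) (hg.prodMap measurable_id)
    fun p => ?_).symm
  exact Prod.ext (hge p.1) rfl

/-- Mutual information is conditional mutual information given a constant. -/
lemma mutualInfo_eq_condMutualInfo {Ω α β : Type*} [MeasurableSpace Ω] [MeasurableSpace α]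
    [StandardBorelSpace α] [Nonempty α] [MeasurableSpace β] (μ : Measure Ω)
    [IsProbabilityMeasure μ] {Y : Ω → α} (hY : Measurable Y) {X : Ω → β} (hX : Measurable X) :
    CIFC.mutualInfo μ Y X = CIFC.condMutualInfo μ Y X fun _ => () := by
  have hprob : IsProbabilityMeasure (μ.map Y) := Measure.isProbabilityMeasure_map hY.aemeasurable
  have hc : condDistrib Y (fun _ : Ω => ()) μ = Kernel.const Unit (μ.map Y) := by
    have h := condDistrib_ae_eq_of_measure_eq_compProd (μ := μ) (fun _ : Ω => ())
      (κ := Kernel.const Unit (μ.map Y)) hY.aemeasurable (by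
        rw [Measure.map_const, measure_univ, one_smul, Measure.dirac_unit_compProd_const,
          Measure.map_map (by fun_prop) hY]
        rfl)
    rw [Measure.map_const, measure_univ, one_smul] at h
    ext1 u
    rw [ae_dirac_eq] at h
    exact h
  rw [CIFC.mutualInfo, CIFC.condMutualInfo, hc]
  congr 1
  have h := klDiv_compProd_comap_eq μ hX hY (Z := fun _ : β => ()) measurable_const
    measurable_id (g := Prod.snd) measurable_snd (fun _ => rfl) (Kernel.const Unit (μ.map Y))
  simp only [id] at h
  rw [← h, ← Measure.compProd_const]
  rfl

lemma condMutualInfo_mul_log {Ω α β γ : Type*} [MeasurableSpace Ω] [MeasurableSpace α]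
    [StandardBorelSpace α] [Nonempty α] [MeasurableSpace β] [MeasurableSpace γ]
    (μ : Measure Ω) [IsFiniteMeasure μ] (Y : Ω → α) (X : Ω → β) (Z : Ω → γ) :
    CIFC.condMutualInfo μ Y X Z * ENNReal.ofReal (Real.log 2)
      = klDiv (μ.map fun ω => ((Z ω, X ω), Y ω))
          ((μ.map fun ω => (Z ω, X ω)) ⊗ₘ (condDistrib Y Z μ).prodMkRight β) := by
  rw [CIFC.condMutualInfo]
  exact ENNReal.div_mul_cancel (by simpa using Real.log_pos one_lt_two) ENNReal.ofReal_ne_top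

/-- The conditional mutual information is finite if `X` takes values in a finite set. -/
lemma klDiv_condDistrib_ne_top {Ω α β γ : Type*} [MeasurableSpace Ω] [MeasurableSpace α]
    [StandardBorelSpace α] [Nonempty α] [MeasurableSpace β] [Finite β]
    [MeasurableSingletonClass β] [MeasurableSpace γ] (μ : Measure Ω) [IsProbabilityMeasure μ]
    {Y : Ω → α} (hY : Measurable Y) {X : Ω → β} (hX : Measurable X) {Z : Ω → γ}
    (hZ : Measurable Z) :
    klDiv (μ.map fun ω => ((Z ω, X ω), Y ω))
      ((μ.map fun ω => (Z ω, X ω)) ⊗ₘ (condDistrib Y Z μ).prodMkRight β) ≠ ∞ := by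
  have := Fintype.ofFinite β
  set Q := condDistrib Y Z μ with hQ
  -- Replacing the law of `X` given `Z` by counting measure dominates the joint law, so the
  -- divergence from the right side is finite. By the chain rule the divergence of interest is one
  -- of its summands.
  have hle : (μ.map fun ω => ((Z ω, X ω), Y ω))
      ≤ ((μ.map Z).prod Measure.count) ⊗ₘ Q.prodMkRight β := by
    refine Measure.le_iff.2 fun s hs => ?_
    rw [Measure.map_apply (by fun_prop) hs, Measure.compProd_apply hs,
      lintegral_prod_symm _ (Kernel.measurable_kernel_prodMk_left hs).aemeasurable,
      lintegral_count, tsum_fintype]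
    have hx : ∀ x : β, ∫⁻ z, (Q.prodMkRight β) (z, x) (Prod.mk (z, x) ⁻¹' s) ∂(μ.map Z)
        = μ {ω | ((Z ω, x), Y ω) ∈ s} := by
      intro x
      have hm : MeasurableSet {p : γ × α | ((p.1, x), p.2) ∈ s} :=
        hs.preimage (f := fun p : γ × α => ((p.1, x), p.2)) (by fun_prop)
      have h := Measure.compProd_apply (μ := μ.map Z) (κ := Q) hm
      rw [hQ, compProd_map_condDistrib hY.aemeasurable, Measure.map_apply (by fun_prop) hm] at h
      exact h.symm
    simp_rw [hx]
    refine (measure_mono ?_).trans (measure_biUnion_finset_le Finset.univ _)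
    intro ω hω
    simp only [Finset.mem_univ, Set.iUnion_true, Set.mem_iUnion]
    exact ⟨X ω, hω⟩
  have hfin := klDiv_ne_top_of_le _ _ hle
  rw [← compProd_map_condDistrib (μ := μ) (X := fun ω => (Z ω, X ω)) hY.aemeasurable,
    klDiv_compProd_eq_add] at hfin
  rw [← compProd_map_condDistrib (μ := μ) (X := fun ω => (Z ω, X ω)) hY.aemeasurable]
  exact fun h => hfin (by rw [h, add_top])

/-- The convex combination of two kernels with weights `a` and `1 - a`. -/
noncomputable def mixKernel {γ α : Type*} [MeasurableSpace γ] [MeasurableSpace α] (a : ℝ)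
    (Q Q' : Kernel γ α) : Kernel γ α where
  toFun z := ENNReal.ofReal a • Q z + ENNReal.ofReal (1 - a) • Q' z
  measurable' := by
    refine Measure.measurable_of_measurable_coe _ fun s hs => ?_
    simp only [Measure.coe_add, Measure.coe_smul, Pi.add_apply, Pi.smul_apply, smul_eq_mul]
    exact ((Q.measurable_coe hs).const_mul _).add ((Q'.measurable_coe hs).const_mul _)

lemma isMarkovKernel_mixKernel {γ α : Type*} [MeasurableSpace γ] [MeasurableSpace α] {a : ℝ}
    (ha : 0 ≤ a) (ha1 : a ≤ 1) (Q Q' : Kernel γ α) [IsMarkovKernel Q] [IsMarkovKernel Q'] :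
    IsMarkovKernel (mixKernel a Q Q') := by
  refine ⟨fun z => ⟨?_⟩⟩
  change (ENNReal.ofReal a • Q z + ENNReal.ofReal (1 - a) • Q' z) Set.univ = 1
  simp only [Measure.coe_add, Measure.coe_smul, Pi.add_apply, Pi.smul_apply, measure_univ,
    smul_eq_mul, mul_one]
  rw [← ENNReal.ofReal_add ha (by linarith)]
  simp

lemma smul_le_mixKernel_left {γ α : Type*} [MeasurableSpace γ] [MeasurableSpace α] (a : ℝ)
    (Q Q' : Kernel γ α) (z : γ) : ENNReal.ofReal a • Q z ≤ mixKernel a Q Q' z :=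
  Measure.le_add_right le_rfl

lemma smul_le_mixKernel_right {γ α : Type*} [MeasurableSpace γ] [MeasurableSpace α] (a : ℝ)
    (Q Q' : Kernel γ α) (z : γ) : ENNReal.ofReal (1 - a) • Q' z ≤ mixKernel a Q Q' z :=
  Measure.le_add_left le_rfl

lemma klDiv_compProd_le_add_log {α β : Type*} [MeasurableSpace α] [MeasurableSpace β]
    (ρ : Measure (α × β)) [IsProbabilityMeasure ρ] (m : Measure α) [IsProbabilityMeasure m]
    (Q Q' : Kernel α β) [IsMarkovKernel Q] [IsMarkovKernel Q'] {a : ℝ} (ha : 0 < a) (ha1 : a ≤ 1)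
    (h : ∀ z, ENNReal.ofReal a • Q z ≤ Q' z) :
    klDiv ρ (m ⊗ₘ Q') ≤ klDiv ρ (m ⊗ₘ Q) + ENNReal.ofReal (- Real.log a) := by
  refine klDiv_le_add_log_of_smul_le _ _ _ ha ha1 (Measure.le_iff.2 fun s hs => ?_)
  rw [Measure.smul_apply, Measure.compProd_apply hs, Measure.compProd_apply hs, smul_eq_mul,
    ← lintegral_const_mul _ (Kernel.measurable_kernel_prodMk_left hs)]
  exact lintegral_mono fun z => h z _

/-- The chain rule for a channel output that is appended to previous outputs. -/
lemma klDiv_compProd_append {𝒳 𝒴 E α : Type*} [MeasurableSpace 𝒳] [MeasurableSpace 𝒴]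
    [MeasurableSpace E] [MeasurableSpace α] [StandardBorelSpace α] [Nonempty α]
    (P : Measure 𝒳) [IsProbabilityMeasure P] (ch : Kernel 𝒳 𝒴) [IsMarkovKernel ch]
    {O : 𝒴 → E} (hO : Measurable O) {y : 𝒴 → α} (hy : Measurable y)
    (V : Kernel 𝒳 E) [IsMarkovKernel V] (Q : Kernel (𝒳 × E) α) [IsMarkovKernel Q] :
    klDiv (P ⊗ₘ ch.map fun o => (O o, y o)) (P ⊗ₘ (V ⊗ₖ Q))
      = klDiv (P ⊗ₘ ch.map O) (P ⊗ₘ V)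
        + klDiv ((P ⊗ₘ ch).map fun ω => ((ω.1, O ω.2), y ω.2))
            (((P ⊗ₘ ch).map fun ω => (ω.1, O ω.2)) ⊗ₘ Q) := by
  have : IsMarkovKernel (ch.map O) := Kernel.IsMarkovKernel.map _ hO
  have : IsMarkovKernel (ch.map fun o => (O o, y o)) := Kernel.IsMarkovKernel.map _ (by fun_prop)
  have hmap : P ⊗ₘ ch.map O = (P ⊗ₘ ch).map fun ω => (ω.1, O ω.2) := Measure.compProd_map hO
  have hmap' : P ⊗ₘ ch.map (fun o => (O o, y o)) = (P ⊗ₘ ch).map fun ω => (ω.1, O ω.2, y ω.2) :=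
    Measure.compProd_map (by fun_prop)
  rw [← klDiv_map_of_leftInverse _ _ MeasurableEquiv.prodAssoc.symm.measurable
    MeasurableEquiv.prodAssoc.measurable MeasurableEquiv.prodAssoc.right_inv,
    Measure.compProd_assoc, hmap', Measure.map_map (MeasurableEquiv.measurable _) (by fun_prop)]
  change klDiv ((P ⊗ₘ ch).map fun ω => ((ω.1, O ω.2), y ω.2)) _ = _
  -- Disintegrating the true law over the input and the earlier outputs brings both arguments into
  -- the form of the chain rule.
  rw [← compProd_map_condDistrib (μ := P ⊗ₘ ch) (X := fun ω => (ω.1, O ω.2))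
    (Y := fun ω => y ω.2) (by fun_prop), klDiv_compProd_eq_add, hmap]

end ConditionalInformation

namespace CIFC

/-! ### Reference channels under which decoding is a blind guess. -/

section Reference

lemma Code.input_update {𝒳 𝒴 : Fin 3 → Type*} [∀ i, MeasurableSpace (𝒴 i)]
    {R : Fin 3 → ℝ} {N : ℕ} (c : Code 𝒳 𝒴 R N) (w : Msg N R) {i j : Fin 3} (hij : i ≠ j)
    (hi : i ≠ 2) (b : Fin (numMsg N (R j))) (t : Fin N) :
    c.input (Function.update w j b) t i = c.input w t i := by
  match i with
  | 0 => simp [Code.input, Function.update_of_ne hij]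
  | 1 => simp [Code.input, Function.update_of_ne hij]
  | 2 => exact absurd rfl hi

universe u v

variable {𝒳 : Fin 3 → Type u} {𝒴 : Fin 3 → Type v}
  [∀ i, MeasurableSpace (𝒳 i)] [∀ i, MeasurableSpace (𝒴 i)]

/-- A reference kernel `V` for the outputs `O` of the users in `T`. It depends on the inputs with
index in `D` only, and under the memoryless channel with kernel `V` all users in `T` decode
correctly with the probability of a blind guess. -/
structure IsReference {E : Type*} [MeasurableSpace E] (T D : Finset (Fin 3))
    (O : (∀ i, 𝒴 i) → E) (V : Kernel (∀ i, 𝒳 i) E) : Prop where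
  markov : IsMarkovKernel V
  dep : ∀ x x' : ∀ i, 𝒳 i, (∀ i ∈ D, x i = x' i) → V x = V x'
  success : ∀ (R : Fin 3 → ℝ) (N : ℕ) (c : Code 𝒳 𝒴 R N), ∃ A : Msg N R → Set (Fin N → E),
    (∀ w, MeasurableSet (A w)) ∧ (∀ w w', (∀ i ∈ T, w i = w' i) → A w = A w') ∧
    (∀ w (y : Fin N → ∀ i, 𝒴 i), (fun t => O (y t)) ∈ A w ↔
      ∀ i ∈ T, c.dec i (fun t => y t i) = w i) ∧
    (∏ i ∈ T, (numMsg N (R i) : ℝ≥0∞)) * ∑ w, Measure.pi (fun t => V (c.input w t)) (A w)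
      = Fintype.card (Msg N R)

lemma isReference_empty :
    IsReference (𝒳 := 𝒳) (𝒴 := 𝒴) ∅ ∅ (fun _ => ()) (Kernel.const _ (Measure.dirac ())) where
  markov := inferInstance
  dep _ _ _ := rfl
  success R N c := by
    refine ⟨fun _ => Set.univ, fun _ => MeasurableSet.univ, fun _ _ _ => rfl, by simp, ?_⟩
    have (w : Msg N R) (t : Fin N) : IsProbabilityMeasure
        (Kernel.const (∀ i, 𝒳 i) (Measure.dirac ()) (c.input w t)) := by
      rw [Kernel.const_apply]; infer_instance
    simp only [measure_univ]
    simp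

/-- Exchanging `w j` with the fresh value `b` is an involution on the pairs `(w, b)`. -/
lemma sum_sum_update {ι : Type*} [Fintype ι] [DecidableEq ι] {n : ι → ℕ}
    (F : (∀ i, Fin (n i)) → ℝ≥0∞) (j : ι) :
    ∑ w, ∑ b, F (Function.update w j b) = n j * ∑ w, F w := by
  have h : ∑ q : (∀ i, Fin (n i)) × Fin (n j), F (Function.update q.1 j q.2)
      = ∑ q : (∀ i, Fin (n i)) × Fin (n j), F q.1 := by
    refine Finset.sum_bij' (fun q _ => (Function.update q.1 j q.2, q.1 j))
      (fun q _ => (Function.update q.1 j q.2, q.1 j)) ?_ ?_ ?_ ?_ ?_ <;> simp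
  rw [Fintype.sum_prod_type, Fintype.sum_prod_type] at h
  rw [h]
  simp [Finset.mul_sum]

/-- The message of user `j` enters only the inputs `j` and `2`, both outside `D'`, and it does not
affect the earlier success event. When it is resampled, the events that user `j` decodes the sampled
value partition the space, so the extra requirement costs exactly the factor `numMsg N (R j)`. -/
lemma IsReference.append {E γ : Type*} [MeasurableSpace E] [MeasurableSpace γ]
    {T D D' : Finset (Fin 3)} {O : (∀ i, 𝒴 i) → E} {V : Kernel (∀ i, 𝒳 i) E}
    (hV : IsReference T D O V) {j : Fin 3} (hjT : j ∉ T) (hDD : D ⊆ D') (hj : j ∉ D')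
    (h2 : 2 ∉ D') {Z : (∀ i, 𝒳 i) × E → γ} (hZ : Measurable Z)
    (hZD : ∀ x x' e, (∀ i ∈ D', x i = x' i) → Z (x, e) = Z (x', e))
    (Q : Kernel γ (𝒴 j)) [IsMarkovKernel Q] :
    IsReference (insert j T) D' (fun y => (O y, y j)) (V ⊗ₖ Q.comap Z hZ) := by
  have := hV.markov
  have hdep : ∀ x x' : ∀ i, 𝒳 i, (∀ i ∈ D', x i = x' i) →
      (V ⊗ₖ Q.comap Z hZ) x = (V ⊗ₖ Q.comap Z hZ) x' := by
    intro x x' h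
    ext s hs
    rw [Kernel.compProd_apply hs, Kernel.compProd_apply hs,
      hV.dep x x' fun i hi => h i (hDD hi)]
    simp only [Kernel.comap_apply, hZD x x' _ h]
  refine ⟨inferInstance, hdep, fun R N c => ?_⟩
  obtain ⟨A, hAm, hAT, hAdec, hAsum⟩ := hV.success R N c
  set V' := V ⊗ₖ Q.comap Z hZ with hV'
  have hfst : Measurable fun (y : Fin N → E × 𝒴 j) t => (y t).1 := by fun_prop
  have hsnd : Measurable fun (y : Fin N → E × 𝒴 j) => c.dec j fun t => (y t).2 :=
    (c.measurable_dec j).comp (by fun_prop)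
  refine ⟨fun w => {y | (fun t => (y t).1) ∈ A w} ∩ {y | c.dec j (fun t => (y t).2) = w j},
    fun w => ?_, fun w w' h => ?_, fun w y => ?_, ?_⟩
  · exact (hfst (hAm w)).inter (hsnd (measurableSet_singleton (w j)))
  · beta_reduce
    rw [hAT w w' fun i hi => h i (Finset.mem_insert_of_mem hi), h j (Finset.mem_insert_self _ _)]
  · rw [Finset.forall_mem_insert, and_comm, ← hAdec]
    rfl
  · rw [Finset.prod_insert hjT, mul_comm (numMsg N (R j) : ℝ≥0∞), mul_assoc, ← hAsum,
      ← sum_sum_update (n := fun i => numMsg N (R i))]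
    congr 1
    refine Finset.sum_congr rfl fun w _ => ?_
    have hin : ∀ b t, V' (c.input (Function.update w j b) t) = V' (c.input w t) := fun b t =>
      hdep _ _ fun i hi => c.input_update w (ne_of_mem_of_not_mem hi hj)
        (ne_of_mem_of_not_mem hi h2) b t
    have hAw : ∀ b, A (Function.update w j b) = A w := fun b =>
      hAT _ _ fun i hi => Function.update_of_ne (ne_of_mem_of_not_mem hi hjT) _ _
    simp only [hin, hAw, Function.update_self]
    -- The appended factor is Markov, so forgetting the output of user `j` recovers `V`.
    have hmap : Measure.pi (fun t => V (c.input w t))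
        = (Measure.pi fun t => V' (c.input w t)).map fun y t => (y t).1 := by
      have h := Measure.pi_map_pi (μ := fun t => V' (c.input w t))
        (f := fun _ : Fin N => (Prod.fst : E × 𝒴 j → E)) (hμ := fun t => by
          rw [← Kernel.fst_apply, hV', Kernel.fst_compProd]; infer_instance)
        fun t => measurable_fst.aemeasurable
      rw [h]
      congr 1
      ext1 t
      rw [← Kernel.fst_apply, hV', Kernel.fst_compProd]
    rw [hmap, Measure.map_apply hfst (hAm w)]
    set ρ := Measure.pi fun t => V' (c.input w t)
    set S := {y : Fin N → E × 𝒴 j | (fun t => (y t).1) ∈ A w}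
    have hS : MeasurableSet S := hfst (hAm w)
    have h := sum_measure_preimage_singleton (μ := ρ.restrict S) Finset.univ
      (f := fun y : Fin N → E × 𝒴 j => c.dec j fun t => (y t).2)
      fun b _ => hsnd (measurableSet_singleton b)
    simp only [Finset.coe_univ, Set.preimage_univ, Measure.restrict_apply_univ] at h
    refine Eq.trans (Finset.sum_congr rfl fun b _ => ?_) h
    rw [Measure.restrict_apply (hsnd (measurableSet_singleton b)), Set.inter_comm]
    rfl

/-- Some reference kernel has a divergence arbitrarily close to `a` under the input law `P`; for
finite input alphabets its divergence under the input law `U` is moreover finite. -/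
def Attains (ch : Kernel (∀ i, 𝒳 i) (∀ i, 𝒴 i)) (P U : Measure (∀ i, 𝒳 i)) {E : Type*}
    [MeasurableSpace E] (T D : Finset (Fin 3)) (O : (∀ i, 𝒴 i) → E) (a : ℝ≥0∞) : Prop :=
  ∀ δ : ℝ, 0 < δ → ∃ V : Kernel (∀ i, 𝒳 i) E, IsReference T D O V ∧
    klDiv (P ⊗ₘ ch.map O) (P ⊗ₘ V) ≤ a + ENNReal.ofReal δ ∧
    ((∀ i, Finite (𝒳 i)) → klDiv (U ⊗ₘ ch.map O) (U ⊗ₘ V) ≠ ∞)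

lemma attains_empty (ch : Kernel (∀ i, 𝒳 i) (∀ i, 𝒴 i)) [IsMarkovKernel ch]
    (P U : Measure (∀ i, 𝒳 i)) [IsProbabilityMeasure P] [IsProbabilityMeasure U] :
    Attains ch P U ∅ ∅ (fun _ => ()) 0 := by
  intro δ _
  have h : ch.map (fun _ => ()) = Kernel.const _ (Measure.dirac ()) := by
    ext1 x
    rw [Kernel.map_apply _ measurable_const, Measure.map_const]
    simp
  refine ⟨_, isReference_empty, ?_, fun _ => ?_⟩ <;> rw [h, klDiv_self] <;> simp

/-- The new output is drawn from its true conditional law given `Z` under `P`, mixed with the one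
under `U`. The map `g` says that `ξ` is what `Z` omits from the input and the earlier outputs, so
the divergence added by the unmixed law is the conditional mutual information with `ξ`. -/
lemma Attains.append [∀ i, StandardBorelSpace (𝒴 i)] [∀ i, Nonempty (𝒴 i)]
    {ch : Kernel (∀ i, 𝒳 i) (∀ i, 𝒴 i)} [IsMarkovKernel ch]
    {P U : Measure (∀ i, 𝒳 i)} [IsProbabilityMeasure P] [IsProbabilityMeasure U]
    {E γ β : Type*} [MeasurableSpace E] [MeasurableSpace γ] [MeasurableSpace β]
    [MeasurableSingletonClass β] {T D : Finset (Fin 3)} {O : (∀ i, 𝒴 i) → E} {a : ℝ≥0∞}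
    (h : Attains ch P U T D O a) (hO : Measurable O) (j : Fin 3) (D' : Finset (Fin 3))
    (hjT : j ∉ T) (hDD : D ⊆ D') (hj : j ∉ D') (h2 : 2 ∉ D')
    (Z : (∀ i, 𝒳 i) × E → γ) (hZ : Measurable Z) (ξ : (∀ i, 𝒳 i) × E → β) (hξ : Measurable ξ)
    (g : γ × β → (∀ i, 𝒳 i) × E) (hg : Measurable g) (hge : ∀ p, g (Z p, ξ p) = p)
    (hZD : ∀ x x' e, (∀ i ∈ D', x i = x' i) → Z (x, e) = Z (x', e))
    (hβ : (∀ i, Finite (𝒳 i)) → Finite β) :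
    Attains ch P U (insert j T) D' (fun y => (O y, y j))
      (a + condMutualInfo (P ⊗ₘ ch) (fun ω => ω.2 j) (fun ω => ξ (ω.1, O ω.2))
        (fun ω => Z (ω.1, O ω.2)) * ENNReal.ofReal (Real.log 2)) := by
  intro δ hδ
  obtain ⟨V, hV, hVP, hVU⟩ := h (δ / 2) (by positivity)
  have := hV.markov
  have hyj : Measurable fun y : ∀ i, 𝒴 i => y j := measurable_pi_apply j
  have hA : Measurable fun ω : (∀ i, 𝒳 i) × (∀ i, 𝒴 i) => (ω.1, O ω.2) := by fun_prop
  have hY : Measurable fun ω : (∀ i, 𝒳 i) × (∀ i, 𝒴 i) => ω.2 j := by fun_prop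
  have hZA := hZ.comp hA
  have hξA := hξ.comp hA
  set QP := condDistrib (fun ω : (∀ i, 𝒳 i) × (∀ i, 𝒴 i) => ω.2 j)
    (fun ω => Z (ω.1, O ω.2)) (P ⊗ₘ ch)
  set QU := condDistrib (fun ω : (∀ i, 𝒳 i) × (∀ i, 𝒴 i) => ω.2 j)
    (fun ω => Z (ω.1, O ω.2)) (U ⊗ₘ ch)
  -- The weight `r` costs `-log r = δ / 2` under `P`, the other half of `δ` having been spent on
  -- `V`. The positive weight `1 - r` keeps the divergence under `U` finite.
  set r := Real.exp (- (δ / 2)) with hr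
  have hr0 : 0 < r := Real.exp_pos _
  have hr1 : r < 1 := Real.exp_lt_one_iff.2 (by linarith)
  have := isMarkovKernel_mixKernel hr0.le hr1.le QP QU
  refine ⟨V ⊗ₖ (mixKernel r QP QU).comap Z hZ, hV.append hjT hDD hj h2 hZ hZD _, ?_,
    fun hfin => ?_⟩
  · rw [klDiv_compProd_append P ch hO hyj,
      klDiv_compProd_comap_eq _ hA hY hZ hξ hg hge, condMutualInfo_mul_log]
    have : IsProbabilityMeasure
        ((P ⊗ₘ ch).map fun ω => ((Z (ω.1, O ω.2), ξ (ω.1, O ω.2)), ω.2 j)) :=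
      Measure.isProbabilityMeasure_map ((hZA.prodMk hξA).prodMk hY).aemeasurable
    have : IsProbabilityMeasure ((P ⊗ₘ ch).map fun ω => (Z (ω.1, O ω.2), ξ (ω.1, O ω.2))) :=
      Measure.isProbabilityMeasure_map (hZA.prodMk hξA).aemeasurable
    refine (add_le_add hVP (klDiv_compProd_le_add_log _ _ (QP.prodMkRight β) _ hr0 hr1.le
      fun z => smul_le_mixKernel_left r QP QU z.1)).trans (le_of_eq ?_)
    rw [hr, Real.log_exp, neg_neg, add_add_add_comm, ← ENNReal.ofReal_add (by positivity)
      (by positivity), add_halves]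
  · have := hβ hfin
    rw [klDiv_compProd_append U ch hO hyj,
      klDiv_compProd_comap_eq _ hA hY hZ hξ hg hge]
    have : IsProbabilityMeasure
        ((U ⊗ₘ ch).map fun ω => ((Z (ω.1, O ω.2), ξ (ω.1, O ω.2)), ω.2 j)) :=
      Measure.isProbabilityMeasure_map ((hZA.prodMk hξA).prodMk hY).aemeasurable
    have : IsProbabilityMeasure ((U ⊗ₘ ch).map fun ω => (Z (ω.1, O ω.2), ξ (ω.1, O ω.2))) :=
      Measure.isProbabilityMeasure_map (hZA.prodMk hξA).aemeasurable
    refine ENNReal.add_ne_top.2 ⟨hVU hfin, ?_⟩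
    refine ne_top_of_le_ne_top (ENNReal.add_ne_top.2 ⟨klDiv_condDistrib_ne_top (U ⊗ₘ ch) hY hξA
      hZA, ENNReal.ofReal_ne_top⟩) (klDiv_compProd_le_add_log _ _ (QU.prodMkRight β) _
        (a := 1 - r) (by linarith) (by linarith) fun z => smul_le_mixKernel_right r QP QU z.1)

end Reference

end CIFC

/-! ### The seven bounds from orderings of the users. -/

namespace CIFC

section Bounds

universe u v

variable {𝒳 : Fin 3 → Type u} {𝒴 : Fin 3 → Type v}
  [∀ i, MeasurableSpace (𝒳 i)] [∀ i, MeasurableSpace (𝒴 i)]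

/-- The input triple with the given components. -/
def triple {𝒳 : Fin 3 → Type*} (a : 𝒳 0) (b : 𝒳 1) (c : 𝒳 2) : ∀ i, 𝒳 i
  | 0 => a
  | 1 => b
  | 2 => c

lemma triple_eta {𝒳 : Fin 3 → Type*} (x : ∀ i, 𝒳 i) : triple (x 0) (x 1) (x 2) = x := by
  funext i
  match i with
  | 0 => rfl
  | 1 => rfl
  | 2 => rfl

lemma _root_.Measurable.triple {𝒳 : Fin 3 → Type*} [∀ i, MeasurableSpace (𝒳 i)] {Ω : Type*}
    [MeasurableSpace Ω] {a : Ω → 𝒳 0} {b : Ω → 𝒳 1} {c : Ω → 𝒳 2}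
    (ha : Measurable a) (hb : Measurable b) (hc : Measurable c) :
    Measurable fun ω => triple (a ω) (b ω) (c ω) := by
  refine measurable_pi_lambda _ fun i => ?_
  match i with
  | 0 => exact ha
  | 1 => exact hb
  | 2 => exact hc

lemma mem_outerRegion_of_attains [∀ i, StandardBorelSpace (𝒳 i)] [∀ i, StandardBorelSpace (𝒴 i)]
    [∀ i, Nonempty (𝒴 i)] (ch : Kernel (∀ i, 𝒳 i) (∀ i, 𝒴 i)) [IsMarkovKernel ch]
    (P : ProbabilityMeasure (∀ i, 𝒳 i)) (U : Measure (∀ i, 𝒳 i)) [IsProbabilityMeasure U]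
    (R : Fin 3 → ℝ)
    (h : ∀ {E : Type v} [MeasurableSpace E] (T D : Finset (Fin 3)) (O : (∀ i, 𝒴 i) → E)
      (a : ℝ≥0∞), T.Nonempty → Measurable O → Attains ch (P : Measure (∀ i, 𝒳 i)) U T D O a →
      ENNReal.ofReal (∑ i ∈ T, R i) * ENNReal.ofReal (Real.log 2) ≤ a) :
    R ∈ outerRegion ch P := by
  have hL0 : ENNReal.ofReal (Real.log 2) ≠ 0 := by simpa using Real.log_pos one_lt_two
  have hcancel : ∀ {x y : ℝ≥0∞},
      x * ENNReal.ofReal (Real.log 2) ≤ y * ENNReal.ofReal (Real.log 2) → x ≤ y :=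
    fun h => (ENNReal.mul_le_mul_iff_left hL0 ENNReal.ofReal_ne_top).1 h
  have h0 := attains_empty ch (P : Measure (∀ i, 𝒳 i)) U
  have fin1 : ∀ i, (∀ i, Finite (𝒳 i)) → Finite (𝒳 i) := fun i h => h i
  have fin2 : ∀ i j, (∀ i, Finite (𝒳 i)) → Finite (𝒳 i × 𝒳 j) := fun i j h => by
    have := h i; have := h j; infer_instance
  have fin3 : ∀ i j k, (∀ i, Finite (𝒳 i)) → Finite (𝒳 i × 𝒳 j × 𝒳 k) := fun i j k h => by
    have := h i; have := h j; have := h k; infer_instance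
  -- Each chain follows the mutual informations of one bound from left to right: the index is the
  -- user whose output is appended, the finite set lists the conditioning inputs, and the map to
  -- `triple` undoes the split into conditioning and remaining variables.
  have a1 := h0.append measurable_const 0 {1} (by simp) (by simp) (by simp) (by simp)
    (fun p => p.1 1) (by fun_prop) (fun p => (p.1 0, p.1 2)) (by fun_prop)
    (fun q => (triple q.2.1 q.1 q.2.2, ()))
    ((Measurable.triple (by fun_prop) (by fun_prop) (by fun_prop)).prodMk measurable_const)
    (fun p => Prod.ext (triple_eta p.1) rfl) (fun x x' e hx => hx 1 (by simp)) (fin2 _ _)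
  have a2 := h0.append measurable_const 1 {0} (by simp) (by simp) (by simp) (by simp)
    (fun p => p.1 0) (by fun_prop) (fun p => (p.1 1, p.1 2)) (by fun_prop)
    (fun q => (triple q.1 q.2.1 q.2.2, ()))
    ((Measurable.triple (by fun_prop) (by fun_prop) (by fun_prop)).prodMk measurable_const)
    (fun p => Prod.ext (triple_eta p.1) rfl) (fun x x' e hx => hx 0 (by simp)) (fin2 _ _)
  have a3 := h0.append measurable_const 2 {0, 1} (by simp) (by simp) (by simp) (by simp)
    (fun p => (p.1 0, p.1 1)) (by fun_prop) (fun p => p.1 2) (by fun_prop)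
    (fun q => (triple q.1.1 q.1.2 q.2, ()))
    ((Measurable.triple (by fun_prop) (by fun_prop) (by fun_prop)).prodMk measurable_const)
    (fun p => Prod.ext (triple_eta p.1) rfl)
    (fun x x' e hx => Prod.ext (hx 0 (by simp)) (hx 1 (by simp))) (fin1 _)
  have a4 := a1.append (by fun_prop) 2 {0, 1} (by simp) (by simp) (by simp) (by simp)
    (fun p => (p.1 1, p.1 0, p.2.2)) (by fun_prop) (fun p => p.1 2) (by fun_prop)
    (fun q => (triple q.1.2.1 q.1.1 q.2, (), q.1.2.2))
    ((Measurable.triple (by fun_prop) (by fun_prop) (by fun_prop)).prodMk (by fun_prop))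
    (fun p => Prod.ext (triple_eta p.1) rfl)
    (fun x x' e hx => by simp [hx 0 (by simp), hx 1 (by simp)]) (fin1 _)
  have a5 := a2.append (by fun_prop) 2 {0, 1} (by simp) (by simp) (by simp) (by simp)
    (fun p => (p.1 0, p.1 1, p.2.2)) (by fun_prop) (fun p => p.1 2) (by fun_prop)
    (fun q => (triple q.1.1 q.1.2.1 q.2, (), q.1.2.2))
    ((Measurable.triple (by fun_prop) (by fun_prop) (by fun_prop)).prodMk (by fun_prop))
    (fun p => Prod.ext (triple_eta p.1) rfl)
    (fun x x' e hx => by simp [hx 0 (by simp), hx 1 (by simp)]) (fin1 _)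
  have a6 := ((h0.append measurable_const 0 ∅ (by simp) (by simp) (by simp) (by simp)
    (fun _ => ()) (by fun_prop) (fun p => (p.1 0, p.1 1, p.1 2)) (by fun_prop)
    (fun q => (triple q.2.1 q.2.2.1 q.2.2.2, ()))
    ((Measurable.triple (by fun_prop) (by fun_prop) (by fun_prop)).prodMk measurable_const)
    (fun p => Prod.ext (triple_eta p.1) rfl) (fun x x' e hx => rfl) (fin3 _ _ _)).append
    (by fun_prop) 1 {0} (by simp) (by simp) (by simp) (by simp)
    (fun p => (p.1 0, p.2.2)) (by fun_prop) (fun p => (p.1 1, p.1 2)) (by fun_prop)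
    (fun q => (triple q.1.1 q.2.1 q.2.2, (), q.1.2))
    ((Measurable.triple (by fun_prop) (by fun_prop) (by fun_prop)).prodMk (by fun_prop))
    (fun p => Prod.ext (triple_eta p.1) rfl)
    (fun x x' e hx => by simp [hx 0 (by simp)]) (fin2 _ _)).append
    (by fun_prop) 2 {0, 1} (by simp) (by simp) (by simp) (by simp)
    (fun p => (p.1 0, p.2.1.2, p.1 1, p.2.2)) (by fun_prop) (fun p => p.1 2) (by fun_prop)
    (fun q => (triple q.1.1 q.1.2.2.1 q.2, ((), q.1.2.1), q.1.2.2.2))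
    ((Measurable.triple (by fun_prop) (by fun_prop) (by fun_prop)).prodMk (by fun_prop))
    (fun p => Prod.ext (triple_eta p.1) rfl)
    (fun x x' e hx => by simp [hx 0 (by simp), hx 1 (by simp)]) (fin1 _)
  have a7 := ((h0.append measurable_const 1 ∅ (by simp) (by simp) (by simp) (by simp)
    (fun _ => ()) (by fun_prop) (fun p => (p.1 1, p.1 0, p.1 2)) (by fun_prop)
    (fun q => (triple q.2.2.1 q.2.1 q.2.2.2, ()))
    ((Measurable.triple (by fun_prop) (by fun_prop) (by fun_prop)).prodMk measurable_const)
    (fun p => Prod.ext (triple_eta p.1) rfl) (fun x x' e hx => rfl) (fin3 _ _ _)).append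
    (by fun_prop) 0 {1} (by simp) (by simp) (by simp) (by simp)
    (fun p => (p.1 1, p.2.2)) (by fun_prop) (fun p => (p.1 0, p.1 2)) (by fun_prop)
    (fun q => (triple q.2.1 q.1.1 q.2.2, (), q.1.2))
    ((Measurable.triple (by fun_prop) (by fun_prop) (by fun_prop)).prodMk (by fun_prop))
    (fun p => Prod.ext (triple_eta p.1) rfl)
    (fun x x' e hx => by simp [hx 1 (by simp)]) (fin2 _ _)).append
    (by fun_prop) 2 {0, 1} (by simp) (by simp) (by simp) (by simp)
    (fun p => (p.1 1, p.2.1.2, p.1 0, p.2.2)) (by fun_prop) (fun p => p.1 2) (by fun_prop)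
    (fun q => (triple q.1.2.2.1 q.1.1 q.2, ((), q.1.2.1), q.1.2.2.2))
    ((Measurable.triple (by fun_prop) (by fun_prop) (by fun_prop)).prodMk (by fun_prop))
    (fun p => Prod.ext (triple_eta p.1) rfl)
    (fun x x' e hx => by simp [hx 0 (by simp), hx 1 (by simp)]) (fin1 _)
  refine ⟨hcancel ?_, hcancel ?_, hcancel ?_, hcancel ?_, hcancel ?_, hcancel ?_, hcancel ?_⟩
  · simpa using h _ _ _ _ (by simp) (by fun_prop) a1
  · simpa using h _ _ _ _ (by simp) (by fun_prop) a2
  · simpa using h _ _ _ _ (by simp) (by fun_prop) a3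
  · simpa [add_mul, add_comm (R 2)] using h _ _ _ _ (by simp) (by fun_prop) a4
  · simpa [add_mul, add_comm (R 2)] using h _ _ _ _ (by simp) (by fun_prop) a5
  · rw [mutualInfo_eq_condMutualInfo _ (by fun_prop) (by fun_prop),
      show R 0 + R 1 + R 2 = R 2 + (R 1 + R 0) by ring]
    simpa [add_mul] using h _ _ _ _ (by simp) (by fun_prop) a6
  · rw [mutualInfo_eq_condMutualInfo _ (by fun_prop) (by fun_prop),
      show R 1 + R 0 + R 2 = R 2 + (R 0 + R 1) by ring]
    simpa [add_mul] using h _ _ _ _ (by simp) (by fun_prop) a7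

end Bounds

end CIFC

namespace CIFC

/-! ### The single-letter converse for one code. -/

section Converse

universe u v

lemma numMsg_pos {N : ℕ} {r : ℝ} (hr : 0 ≤ r) : 0 < numMsg N r := by
  rw [numMsg, Nat.floor_pos]
  exact Real.one_le_rpow one_le_two (by positivity)

lemma log_numMsg_le {N : ℕ} {r : ℝ} (hr : 0 ≤ r) :
    Real.log (numMsg N r) ≤ N * r * Real.log 2 := by
  rw [← Real.log_rpow two_pos]
  exact Real.log_le_log (by exact_mod_cast numMsg_pos hr) (Nat.floor_le (by positivity))

/-- Rounding down a number that is at least one loses at most a factor two, that is, one bit. -/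
lemma le_log_numMsg {N : ℕ} {r : ℝ} (hr : 0 ≤ r) :
    (N * r - 1) * Real.log 2 ≤ Real.log (numMsg N r) := by
  have h1 : (1 : ℝ) ≤ numMsg N r := by exact_mod_cast numMsg_pos hr
  have h2 : (2 : ℝ) ^ (N * r) < numMsg N r + 1 := Nat.lt_floor_add_one _
  rw [← Real.log_rpow two_pos, Real.rpow_sub two_pos, Real.rpow_one]
  exact Real.log_le_log (by positivity) (by linarith)

variable {𝒳 : Fin 3 → Type u} {𝒴 : Fin 3 → Type v}
  [∀ i, MeasurableSpace (𝒳 i)] [∀ i, MeasurableSpace (𝒴 i)]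

/-- The law of the input triple at a uniformly chosen time, for uniform messages. -/
noncomputable def Code.inputLaw {R : Fin 3 → ℝ} {N : ℕ} (c : Code 𝒳 𝒴 R N) :
    Measure (∀ i, 𝒳 i) :=
  ∑ q : Msg N R × Fin N,
    (Fintype.card (Msg N R × Fin N) : ℝ≥0∞)⁻¹ • Measure.dirac (c.input q.1 q.2)

lemma Code.isProbabilityMeasure_inputLaw {R : Fin 3 → ℝ} {N : ℕ} (c : Code 𝒳 𝒴 R N)
    (hR : ∀ i, 0 ≤ R i) (hN : 0 < N) : IsProbabilityMeasure c.inputLaw := by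
  have : Nonempty (Msg N R × Fin N) := ⟨(fun i => ⟨0, numMsg_pos (hR i)⟩), ⟨0, hN⟩⟩
  refine ⟨?_⟩
  simp only [Code.inputLaw, Measure.coe_finsetSum, Finset.sum_apply, Measure.smul_apply,
    measure_univ, smul_eq_mul, mul_one, Finset.sum_const, Finset.card_univ, nsmul_eq_mul]
  exact ENNReal.mul_inv_cancel (Nat.cast_ne_zero.2 Fintype.card_ne_zero) (ENNReal.natCast_ne_top _)

lemma Code.errorProb_nonneg (ch : Kernel (∀ i, 𝒳 i) (∀ i, 𝒴 i)) {R : Fin 3 → ℝ} {N : ℕ}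
    (c : Code 𝒳 𝒴 R N) (i : Fin 3) : 0 ≤ c.errorProb ch i :=
  div_nonneg (Finset.sum_nonneg fun _ _ => measureReal_nonneg) (Nat.cast_nonneg _)

/-- The loss in the rate bounds for a code of block length `N`. -/
noncomputable def Code.slack (ch : Kernel (∀ i, 𝒳 i) (∀ i, 𝒴 i)) {R : Fin 3 → ℝ} {N : ℕ}
    (c : Code 𝒳 𝒴 R N) : ℝ :=
  4 / N + (∑ i, R i) * ∑ i, c.errorProb ch i

/-- The converse: the rates of a code are bounded by the averaged divergence of the channel from
any reference kernel. -/
lemma IsReference.ofReal_rate_le [∀ i, MeasurableSingletonClass (𝒳 i)]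
    (ch : Kernel (∀ i, 𝒳 i) (∀ i, 𝒴 i)) [IsMarkovKernel ch]
    {E : Type*} [MeasurableSpace E] {T D : Finset (Fin 3)} {O : (∀ i, 𝒴 i) → E}
    {V : Kernel (∀ i, 𝒳 i) E} (hV : IsReference T D O V) (hO : Measurable O)
    {R : Fin 3 → ℝ} (hR : ∀ i, 0 ≤ R i) {N : ℕ} (hN : 0 < N) (c : Code 𝒳 𝒴 R N) :
    ENNReal.ofReal ((∑ i ∈ T, R i - c.slack ch) * Real.log 2)
      ≤ ∫⁻ x, klDiv (ch.map O x) (V x) ∂c.inputLaw := by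
  have := hV.markov
  have : IsMarkovKernel (ch.map O) := Kernel.IsMarkovKernel.map _ hO
  have : Nonempty (Msg N R) := ⟨fun i => ⟨0, numMsg_pos (hR i)⟩⟩
  obtain ⟨A, hAm, -, hAdec, hAsum⟩ := hV.success R N c
  set M : ℝ := ((Fintype.card (Msg N R) : ℕ) : ℝ) with hM
  have hMpos : 0 < M := Nat.cast_pos.2 Fintype.card_pos
  have hNpos : (0 : ℝ) < N := by exact_mod_cast hN
  -- With this `s`, `exp s` is the inverse of the blind-guess probability, so the penalty term in
  -- `ofReal_event_le_klDiv` averages to zero over the messages.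
  set s : ℝ := ∑ i ∈ T, Real.log (numMsg N (R i)) with hs
  set κ : Msg N R → Measure (Fin N → E) := fun w => Measure.pi fun t => ch.map O (c.input w t)
  set ν : Msg N R → Measure (Fin N → E) := fun w => Measure.pi fun t => V (c.input w t)
  set err : Fin 3 → ℝ := fun i => c.errorProb ch i
  have hexp : Real.exp s = ∏ i ∈ T, (numMsg N (R i) : ℝ) := by
    rw [hs, Real.exp_sum]
    exact Finset.prod_congr rfl fun i _ => Real.exp_log (by exact_mod_cast numMsg_pos (hR i))
  have hν : ∑ w, Real.exp s * (ν w).real (A w) = M := by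
    have h := congrArg ENNReal.toReal hAsum
    rw [ENNReal.toReal_mul, ENNReal.toReal_prod, ENNReal.toReal_sum fun w _ => measure_ne_top _ _]
      at h
    simp only [ENNReal.toReal_natCast] at h
    rw [← Finset.mul_sum, hexp]
    exact h
  have hκ : ∀ w, 1 - ∑ i ∈ T, (blockLaw ch (c.input w)).real {y | c.dec i (fun t => y t i) ≠ w i}
      ≤ (κ w).real (A w) := by
    intro w
    have hmeas : Measurable fun (y : Fin N → ∀ i, 𝒴 i) t => O (y t) := by fun_prop
    have hmap : κ w = (blockLaw ch (c.input w)).map fun y t => O (y t) := by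
      have h := Measure.pi_map_pi (μ := fun t => ch (c.input w t)) (f := fun _ : Fin N => O)
        (hμ := fun t => by
          have := Measure.isProbabilityMeasure_map (μ := ch (c.input w t)) hO.aemeasurable
          infer_instance)
        fun t => hO.aemeasurable
      rw [blockLaw, h]
      simp only [κ, Kernel.map_apply _ hO]
    have : IsProbabilityMeasure (blockLaw ch (c.input w)) := by
      unfold blockLaw; infer_instance
    rw [hmap, map_measureReal_apply hmeas (hAm w)]
    have hc := probReal_compl_eq_one_sub (μ := blockLaw ch (c.input w)) (hmeas (hAm w))
    have hsub : ((fun (y : Fin N → ∀ i, 𝒴 i) t => O (y t)) ⁻¹' A w)ᶜ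
        ⊆ ⋃ i ∈ T, {y | c.dec i (fun t => y t i) ≠ w i} := by
      intro y hy
      rw [Set.mem_compl_iff, Set.mem_preimage, hAdec] at hy
      push Not at hy
      simpa using hy
    have := (measureReal_mono (μ := blockLaw ch (c.input w)) hsub (measure_ne_top _ _)).trans
      (measureReal_biUnion_finset_le T _)
    linarith
  have hκsum : M * (1 - ∑ i ∈ T, err i) ≤ ∑ w, (κ w).real (A w) := by
    refine le_trans (le_of_eq ?_) (Finset.sum_le_sum fun w _ => hκ w)
    rw [Finset.sum_sub_distrib, Finset.sum_comm, mul_sub, Finset.mul_sum]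
    simp only [err, Code.errorProb, Finset.sum_const, Finset.card_univ, nsmul_eq_mul]
    rw [← hM]
    congr 1
    refine Finset.sum_congr rfl fun i _ => ?_
    field_simp
  have hs0 : 0 ≤ s := Finset.sum_nonneg fun i _ => Real.log_nonneg
    (by exact_mod_cast numMsg_pos (hR i))
  have herr : ∀ i, 0 ≤ err i := c.errorProb_nonneg ch
  have hL : 0 < Real.log 2 := Real.log_pos one_lt_two
  have hs_le : s ≤ N * (∑ i, R i) * Real.log 2 := by
    rw [hs, Finset.mul_sum, Finset.sum_mul]
    exact (Finset.sum_le_sum fun i _ => log_numMsg_le (hR i)).trans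
      (Finset.sum_le_sum_of_subset_of_nonneg (Finset.subset_univ _)
        fun i _ _ => by have := hR i; positivity)
  have hs_ge : (N * (∑ i ∈ T, R i) - 3) * Real.log 2 ≤ s := by
    have h1 : ∑ i ∈ T, (N * R i - 1) * Real.log 2 ≤ s :=
      Finset.sum_le_sum fun i _ => le_log_numMsg (hR i)
    rw [← Finset.sum_mul, Finset.sum_sub_distrib, ← Finset.mul_sum] at h1
    have h2 : ∑ i ∈ T, (1 : ℝ) ≤ 3 := by
      have := Finset.card_le_univ T
      rw [Fintype.card_fin] at this
      simp only [Finset.sum_const, nsmul_eq_mul, mul_one]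
      exact_mod_cast this
    nlinarith
  have hmain : ENNReal.ofReal (M * N * ((∑ i ∈ T, R i - c.slack ch) * Real.log 2))
      ≤ ∑ w, klDiv (κ w) (ν w) := by
    calc _ ≤ ENNReal.ofReal (∑ w, (s * (κ w).real (A w) - Real.log 2
          - (Real.exp s * (ν w).real (A w) - 1) / 2)) := by
          refine ENNReal.ofReal_le_ofReal ?_
          rw [Finset.sum_sub_distrib, Finset.sum_sub_distrib, ← Finset.sum_div,
            Finset.sum_sub_distrib, hν, ← Finset.mul_sum]
          simp only [Finset.sum_const, Finset.card_univ, nsmul_eq_mul, mul_one]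
          rw [← hM, sub_self, zero_div, sub_zero]
          have h1 := mul_le_mul_of_nonneg_left hκsum hs0
          have h2 : ∑ i ∈ T, err i ≤ ∑ i, err i :=
            Finset.sum_le_sum_of_subset_of_nonneg (Finset.subset_univ _) fun i _ _ => herr i
          have h3 : s * ∑ i ∈ T, err i ≤ N * (∑ i, R i) * Real.log 2 * ∑ i, err i :=
            mul_le_mul hs_le h2 (Finset.sum_nonneg fun i _ => herr i) (hs0.trans hs_le)
          -- Of the 4 bits, at most 3 come from rounding the message counts and 1 from the `log 2`
          -- of the event bound.
          have h4 : N * c.slack ch = 4 + N * (∑ i, R i) * ∑ i, err i := by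
            simp only [Code.slack, err]
            field_simp
          have h5 : N * ((∑ i ∈ T, R i - c.slack ch) * Real.log 2)
              ≤ s * (1 - ∑ i ∈ T, err i) - Real.log 2 := by
            calc _ = (N * ∑ i ∈ T, R i - N * c.slack ch) * Real.log 2 := by ring
              _ ≤ _ := by rw [h4]; linarith
          have h6 := mul_le_mul_of_nonneg_left h5 hMpos.le
          linarith
      _ ≤ ∑ w, ENNReal.ofReal (s * (κ w).real (A w) - Real.log 2
          - (Real.exp s * (ν w).real (A w) - 1) / 2) := by
          induction (Finset.univ : Finset (Msg N R)) using Finset.induction_on with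
          | empty => simp
          | insert w S hw ih =>
            rw [Finset.sum_insert hw, Finset.sum_insert hw]
            exact ENNReal.ofReal_add_le.trans (add_le_add le_rfl ih)
      _ ≤ _ := Finset.sum_le_sum fun w _ => ofReal_event_le_klDiv (κ w) (ν w) (hAm w) s
  -- Given the messages, the inputs are deterministic and both block laws are products, so
  -- `klDiv_pi` turns the average over time into the block divergence.
  have hlint : ∫⁻ x, klDiv (ch.map O x) (V x) ∂c.inputLaw
      = (ENNReal.ofReal (M * N))⁻¹ * ∑ w, klDiv (κ w) (ν w) := by
    rw [Code.inputLaw, lintegral_finsetSum_measure]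
    simp only [lintegral_smul_measure, lintegral_dirac, smul_eq_mul]
    rw [← Finset.mul_sum, Fintype.sum_prod_type]
    congr 1
    · rw [hM, Fintype.card_prod, Fintype.card_fin]
      norm_cast
    · exact Finset.sum_congr rfl fun w _ => (klDiv_pi _ _).symm
  rw [hlint, ← ENNReal.div_eq_inv_mul, ENNReal.le_div_iff_mul_le
    (Or.inl (by simpa using mul_pos hMpos hNpos)) (Or.inl ENNReal.ofReal_ne_top), mul_comm,
    ← ENNReal.ofReal_mul (by positivity)]
  exact hmain

end Converse

end CIFC

namespace CIFC

/-! ### Passage to the limit: closure, and compactness for finite alphabets. -/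

section Region

universe u v

variable {𝒳 : Fin 3 → Type u} {𝒴 : Fin 3 → Type v}
  [∀ i, MeasurableSpace (𝒳 i)] [∀ i, MeasurableSpace (𝒴 i)]

lemma Code.slack_nonneg (ch : Kernel (∀ i, 𝒳 i) (∀ i, 𝒴 i)) {R : Fin 3 → ℝ} {N : ℕ}
    (hR : ∀ i, 0 ≤ R i) (c : Code 𝒳 𝒴 R N) : 0 ≤ c.slack ch :=
  add_nonneg (by positivity) (mul_nonneg (Finset.sum_nonneg fun i _ => hR i)
    (Finset.sum_nonneg fun i _ => c.errorProb_nonneg ch i))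

lemma tendsto_slack (ch : Kernel (∀ i, 𝒳 i) (∀ i, 𝒴 i)) {R : Fin 3 → ℝ}
    (c : ∀ N, Code 𝒳 𝒴 R N)
    (hc : Tendsto (fun N => ⨆ i, (c N).errorProb ch i) atTop (𝓝 0)) :
    Tendsto (fun N => (c N).slack ch) atTop (𝓝 0) := by
  have herr : ∀ i, Tendsto (fun N => (c N).errorProb ch i) atTop (𝓝 0) := fun i =>
    squeeze_zero (fun N => (c N).errorProb_nonneg ch i)
      (fun N => le_ciSup (f := fun i => (c N).errorProb ch i) (Set.finite_range _).bddAbove i) hc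
  have h1 : Tendsto (fun N : ℕ => (4 : ℝ) / N) atTop (𝓝 0) :=
    tendsto_const_nhds.div_atTop tendsto_natCast_atTop_atTop
  have h2 := (tendsto_finsetSum Finset.univ fun i _ => herr i).const_mul (∑ i, R i)
  simpa [Code.slack] using h1.add h2

variable [∀ i, StandardBorelSpace (𝒳 i)] [∀ i, StandardBorelSpace (𝒴 i)] [∀ i, Nonempty (𝒴 i)]
  (ch : Kernel (∀ i, 𝒳 i) (∀ i, 𝒴 i)) [IsMarkovKernel ch]

/-- Reduced rates may be negative, which is harmless since the region truncates by `ENNReal.ofReal`.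
Every bound involves at least one rate, so it absorbs the slack at least once. -/
lemma Code.sub_slack_mem_outerRegion {R : Fin 3 → ℝ} (hR : ∀ i, 0 ≤ R i) {N : ℕ} (hN : 0 < N)
    (c : Code 𝒳 𝒴 R N) :
    (fun i => R i - c.slack ch)
      ∈ outerRegion ch ⟨c.inputLaw, c.isProbabilityMeasure_inputLaw hR hN⟩ := by
  have := c.isProbabilityMeasure_inputLaw hR hN
  refine mem_outerRegion_of_attains ch _ c.inputLaw _ fun T D O a hT hO h => ?_
  have hL : 0 < Real.log 2 := Real.log_pos one_lt_two
  refine ENNReal.le_of_forall_pos_le_add fun ε hε _ => ?_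
  obtain ⟨V, hV, hVP, -⟩ := h ε hε
  have := hV.markov
  have : IsMarkovKernel (ch.map O) := Kernel.IsMarkovKernel.map _ hO
  rw [ENNReal.ofReal_coe_nnreal] at hVP
  refine le_trans ?_ hVP
  refine le_trans ?_ (lintegral_klDiv_le_klDiv_compProd (ch.map O) V _ _ c.inputLaw rfl)
  refine le_trans ?_ (hV.ofReal_rate_le ch hO hR hN c)
  rw [← ENNReal.ofReal_mul' hL.le]
  refine ENNReal.ofReal_le_ofReal (mul_le_mul_of_nonneg_right ?_ hL.le)
  rw [Finset.sum_sub_distrib, Finset.sum_const, nsmul_eq_mul]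
  have h1 : (1 : ℝ) ≤ T.card := by exact_mod_cast hT.card_pos
  have := c.slack_nonneg ch hR
  nlinarith

lemma capacityRegion_subset_closure :
    capacityRegion ch ⊆ closure (⋃ P : ProbabilityMeasure (∀ i, 𝒳 i), outerRegion ch P) := by
  rintro R ⟨hR, c, hc⟩
  refine mem_closure_of_tendsto (f := fun N i => R i - (c N).slack ch) (b := atTop) ?_ ?_
  · refine tendsto_pi_nhds.2 fun i => ?_
    simpa using (tendsto_slack ch c hc).const_sub (R i)
  · filter_upwards [eventually_gt_atTop 0] with N hN
    exact Set.mem_iUnion.2 ⟨_, (c N).sub_slack_mem_outerRegion ch hR hN⟩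

lemma capacityRegion_subset_of_finite (hfin : ∀ i, Finite (𝒳 i)) :
    capacityRegion ch ⊆ ⋃ P : ProbabilityMeasure (∀ i, 𝒳 i), outerRegion ch P := by
  classical
  rintro R ⟨hR, c, hc⟩
  have := Fintype.ofFinite (∀ i, 𝒳 i)
  have hne : Nonempty (∀ i, 𝒳 i) :=
    ⟨(c 1).input (fun i => ⟨0, numMsg_pos (hR i)⟩) ⟨0, one_pos⟩⟩
  -- The shift skips block length `0`, for which the input law is the zero measure.
  have hprob := fun n => (c (n + 1)).isProbabilityMeasure_inputLaw hR n.succ_pos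
  set p : ℕ → (∀ i, 𝒳 i) → ℝ := fun n x => (c (n + 1)).inputLaw.real {x} with hp
  have hmem : ∀ n, p n ∈ stdSimplex ℝ (∀ i, 𝒳 i) := fun n =>
    ⟨fun _ => measureReal_nonneg, by
      simp only [hp]
      rw [sum_measureReal_singleton, Finset.coe_univ, probReal_univ]⟩
  obtain ⟨q, hq, φ, hφ, hlim⟩ := (isCompact_stdSimplex ℝ (∀ i, 𝒳 i)).tendsto_subseq hmem
  set P : Measure (∀ i, 𝒳 i) := ∑ x, ENNReal.ofReal (q x) • Measure.dirac x with hP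
  have hPprob : IsProbabilityMeasure P := by
    refine ⟨?_⟩
    simp only [hP, Measure.coe_finsetSum, Finset.sum_apply, Measure.smul_apply, measure_univ,
      smul_eq_mul, mul_one]
    rw [← ENNReal.ofReal_sum_of_nonneg fun x _ => hq.1 x, hq.2, ENNReal.ofReal_one]
  -- The uniform law charges every input, so finite divergence under `U` forces finite divergence at
  -- each input.
  set U : Measure (∀ i, 𝒳 i) :=
    ∑ x, (Fintype.card (∀ i, 𝒳 i) : ℝ≥0∞)⁻¹ • Measure.dirac x with hU
  have hUprob : IsProbabilityMeasure U := by
    refine ⟨?_⟩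
    simp only [hU, Measure.coe_finsetSum, Finset.sum_apply, Measure.smul_apply, measure_univ,
      smul_eq_mul, mul_one, Finset.sum_const, Finset.card_univ, nsmul_eq_mul]
    exact ENNReal.mul_inv_cancel (Nat.cast_ne_zero.2 Fintype.card_ne_zero)
      (ENNReal.natCast_ne_top _)
  refine Set.mem_iUnion.2 ⟨⟨P, hPprob⟩,
    mem_outerRegion_of_attains ch _ U _ fun T D O a hT hO h => ?_⟩
  have hL : 0 < Real.log 2 := Real.log_pos one_lt_two
  refine ENNReal.le_of_forall_pos_le_add fun ε hε _ => ?_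
  obtain ⟨V, hV, hVP, hVU⟩ := h ε hε
  have := hV.markov
  have : IsMarkovKernel (ch.map O) := Kernel.IsMarkovKernel.map _ hO
  rw [ENNReal.ofReal_coe_nnreal] at hVP
  refine le_trans ?_ hVP
  refine le_trans ?_ (lintegral_klDiv_le_klDiv_compProd (ch.map O) V _ _ P hP)
  set d : (∀ i, 𝒳 i) → ℝ≥0∞ := fun x => klDiv (ch.map O x) (V x) with hd
  have hdtop : ∀ x, d x ≠ ∞ := by
    intro x hx
    refine hVU hfin (top_le_iff.1 (le_trans ?_
      (lintegral_klDiv_le_klDiv_compProd (ch.map O) V _ _ U hU)))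
    rw [hU, lintegral_finsetSum_measure]
    simp only [lintegral_smul_measure, lintegral_dirac, smul_eq_mul]
    refine le_trans (le_of_eq ?_) (Finset.single_le_sum (fun _ _ => zero_le) (Finset.mem_univ x))
    change ∞ = _ * d x
    rw [hx, ENNReal.mul_top]
    exact ENNReal.inv_ne_zero.2 (ENNReal.natCast_ne_top _)
  -- The integrand `d` is fixed, so this is convergence of a finite sum that is linear in the
  -- weights; finiteness of `d` excludes a limit of the form `0 * ∞`.
  have hPlim : Tendsto (fun n => ∫⁻ x, d x ∂(c (φ n + 1)).inputLaw) atTop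
      (𝓝 (∫⁻ x, d x ∂P)) := by
    have h1 : ∀ n, ∫⁻ x, d x ∂(c (φ n + 1)).inputLaw = ∑ x, ENNReal.ofReal (p (φ n) x) * d x := by
      intro n
      rw [lintegral_fintype]
      refine Finset.sum_congr rfl fun x _ => ?_
      rw [hp, mul_comm, ofReal_measureReal]
    have h2 : ∫⁻ x, d x ∂P = ∑ x, ENNReal.ofReal (q x) * d x := by
      rw [hP, lintegral_finsetSum_measure]
      simp only [lintegral_smul_measure, lintegral_dirac, smul_eq_mul]
    rw [h2]
    simp only [h1]
    refine tendsto_finsetSum _ fun x _ => ENNReal.Tendsto.mul_const ?_ (Or.inr (hdtop x))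
    exact (ENNReal.continuous_ofReal.tendsto _).comp (tendsto_pi_nhds.1 hlim x)
  have hRlim : Tendsto (fun n => ENNReal.ofReal
      ((∑ i ∈ T, R i - (c (φ n + 1)).slack ch) * Real.log 2)) atTop
      (𝓝 (ENNReal.ofReal ((∑ i ∈ T, R i) * Real.log 2))) := by
    have h1 : Tendsto (fun n => φ n + 1) atTop atTop :=
      (tendsto_add_atTop_nat 1).comp hφ.tendsto_atTop
    have h2 := (((tendsto_slack ch c hc).comp h1).const_sub (∑ i ∈ T, R i)).mul_const (Real.log 2)
    rw [sub_zero] at h2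
    exact (ENNReal.continuous_ofReal.tendsto _).comp h2
  rw [← ENNReal.ofReal_mul' hL.le]
  exact le_of_tendsto_of_tendsto' hRlim hPlim fun n =>
    hV.ofReal_rate_le ch hO hR (φ n).succ_pos (c (φ n + 1))

end Region

end CIFC

theorem mainTheorem1 {𝒳 : Fin 3 → Type*} {𝒴 : Fin 3 → Type*}
    [∀ i, MeasurableSpace (𝒳 i)] [∀ i, StandardBorelSpace (𝒳 i)]
    [∀ i, MeasurableSpace (𝒴 i)] [∀ i, StandardBorelSpace (𝒴 i)] [∀ i, Nonempty (𝒴 i)]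
    (ch : Kernel (∀ i, 𝒳 i) (∀ i, 𝒴 i)) [IsMarkovKernel ch] :
    CIFC.capacityRegion ch ⊆
        closure (⋃ P : ProbabilityMeasure (∀ i, 𝒳 i), CIFC.outerRegion ch P) ∧
      ((∀ i, Finite (𝒳 i)) → CIFC.capacityRegion ch ⊆
        ⋃ P : ProbabilityMeasure (∀ i, 𝒳 i), CIFC.outerRegion ch P) :=
  ⟨CIFC.capacityRegion_subset_closure ch, CIFC.capacityRegion_subset_of_finite ch⟩
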